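/- Let $T>0$, let $(\Omega,\mathcal F,P)$ be a complete probability space with a right-continuous filtration $(\mathcal F_t)_{0\le t\le T}$, $\mathcal F_T=\mathcal F$. For each $t\in[0,T]$ let $L_t\subseteq L_\infty(\mathcal F_t)$ be a linear subspace with $1\in L_t$ and $L_t\subseteq L_T$. For $0\le s\le t\le T$ let $x_{st}:L_t\to L_s$ be a price operator, that is, $x_{st}$ is monotone; strictly monotone ($X'\ge X''$ a.s. and $X'>X''$ on a set of positive measure imply the same for $x_{st}(X')$, $x_{st}(X'')$); additive; $\mathcal F_s$-homogeneous ($x_{st}(\lambda X)=\lambda x_{st}(X)$ whenever $X\in L_t$, $\lambda\in L_\infty^+(\mathcal F_s)$ and $\lambda X\in L_t$); and $x_{st}(1)=1$. Assume that the family is time-consistent, $x_{st}(X)=x_{su}(x_{ut}(X))$ for $s\le u\le t$ and $X\in L_t$, and right-continuous: for $X\in L_t$ and every non-increasing sequence $s_n\in(s,t]$ with $s_n\to s$, $x_{s_nt}(X)\to x_{st}(X)$ $P$-a.s. For $0\le s\le t\le T$ let $m_{st},M_{st}\in L_1(\mathcal F_t)$ with $0<m_{st}\le M_{st}$ $P$-a.s.,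 with $m_{rs}m_{st}=m_{rt}$ and $M_{rs}M_{st}=M_{rt}$ for all $r\le s\le t$, and with $m_{tt}=M_{tt}=1$ and $m_{tt'}\to1$, $M_{tt'}\to1$ in probability as $t'\downarrow t$ (this holds in particular if the convergence is $P$-a.s. along every sequence $t'_n\downarrow t$ or in $L_1$). For $X\in L_\infty^+(\mathcal F_t)$ put $$m_{st}(X):=E[m_{st}X\mid\mathcal F_s],\qquad M_{st}(X):=E[M_{st}X\mid\mathcal F_s].$$ Assume the sandwich condition: for all $0\le s\le t\le T$, $$m_{st}(Z)+x_{st}(X)\le M_{st}(Y)\quad\text{for all } X\in L_t,\ Y,Z\in L_\infty^+(\mathcal F_t)\text{ with } Z+X\le Y.$$ Then there exist $f\in L_1^+(\mathcal F)$ with $E[f\mid\mathcal F_0]=1$ and a probability measure $P_0$ with $dP_0=f\,dP$ and $P_0\sim P$ such that, for all $0\le s\le t\le T$ and all $X\in L_t$, the variable $X f/E[f\mid\mathcal F_s]$ is $P$-integrable and $$x_{st}(X)=E_{P_0}[X\mid\mathcal F_s]=E\Big[X\frac{f}{E[f\mid\mathcal F_s]}\,\Big|\,\mathcal F_s\Big],$$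 and, for all $0\le s\le t\le T$, $P$-a.s. $E[f\mid\mathcal F_s]>0$ and $$m_{st}\le\frac{E[f\mid\mathcal F_t]}{E[f\mid\mathcal F_s]}\le M_{st}.$$ -/

import Mathlib

open MeasureTheory Filter Topology
open scoped ENNReal

namespace PricingBounds

/-- The set of trading times `[0, T]`. -/
abbrev Times (T : ℝ) : Type := Set.Icc (0 : ℝ) T

section

variable {Ω : Type*} {mΩ : MeasurableSpace Ω}

/-- The constant claim `1` in `L_∞`. -/
noncomputable def one (P : Measure Ω) [IsProbabilityMeasure P] : Lp ℝ ∞ P := Lp.const ∞ P (1 : ℝ)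

/-- `X` belongs to `L_∞^+(𝓖)`, the non-negative cone of the space of (classes of) essentially
bounded `𝓖`-measurable random variables. -/
def MemLinftyPos (P : Measure Ω) (𝓖 : MeasurableSpace Ω) (X : Lp ℝ ∞ P) : Prop :=
  AEStronglyMeasurable[𝓖] X P ∧ 0 ≤ X

/-- The operator `X ↦ E[d X | 𝓖]` with density `d`. -/
noncomputable def densityOp (P : Measure Ω) (𝓖 : MeasurableSpace Ω) (d : Ω → ℝ)
    (X : Lp ℝ ∞ P) : Ω → ℝ :=
  P[fun ω => d ω * X ω | 𝓖]

/-- A price operator from a space `Lt` of claims to a space `Ls` of claims, where `𝓖` is the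
σ-algebra of the earlier time. `X < Y` in `L_∞` means that `X ≤ Y` almost surely and that `X < Y`
on a set of positive measure. -/
structure IsPriceOperator (P : Measure Ω) [IsProbabilityMeasure P] (𝓖 : MeasurableSpace Ω)
    (Lt Ls : Submodule ℝ (Lp ℝ ∞ P)) (x : Lt → Ls) : Prop where
  monotone : ∀ X Y : Lt, (X : Lp ℝ ∞ P) ≤ Y → (x X : Lp ℝ ∞ P) ≤ x Y
  strictMonotone : ∀ X Y : Lt, (X : Lp ℝ ∞ P) < Y → (x X : Lp ℝ ∞ P) < x Y
  additive : ∀ X Y : Lt, x (X + Y) = x X + x Y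
  homogeneous : ∀ (X Y : Lt) (l : Lp ℝ ∞ P), MemLinftyPos P 𝓖 l →
    ((Y : Lp ℝ ∞ P) : Ω → ℝ) =ᵐ[P] (fun ω => l ω * (X : Lp ℝ ∞ P) ω) →
    ((x Y : Lp ℝ ∞ P) : Ω → ℝ) =ᵐ[P] (fun ω => l ω * (x X : Lp ℝ ∞ P) ω)
  map_one : ∀ X : Lt, (X : Lp ℝ ∞ P) = one P → (x X : Lp ℝ ∞ P) = one P

/-- The spaces `L t ⊆ L_∞(𝓕 t)` of marketed claims payable at time `t`: linear subspaces that
contain the numéraire `1`, with every `L t` contained in `L T`. -/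
structure IsMarket {T : ℝ} (P : Measure Ω) [IsProbabilityMeasure P]
    (𝓕 : Filtration (Times T) mΩ) (L : Times T → Submodule ℝ (Lp ℝ ∞ P)) : Prop where
  measurable : ∀ t, L t ≤ lpMeas ℝ ℝ (𝓕 t) ∞ P
  one_mem : ∀ t, one P ∈ L t
  le_terminal : ∀ t u : Times T, (u : ℝ) = T → L t ≤ L u

/-- A time-consistent and right-continuous family of price operators `x s t : L t → L s`,
`s ≤ t`. (The values of `x s t` for `t < s` play no role.) -/
structure IsPriceFamily {T : ℝ} (P : Measure Ω) [IsProbabilityMeasure P]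
    (𝓕 : Filtration (Times T) mΩ) (L : Times T → Submodule ℝ (Lp ℝ ∞ P))
    (x : ∀ s t : Times T, L t → L s) : Prop where
  priceOperator : ∀ s t, s ≤ t → IsPriceOperator P (𝓕 s) (L t) (L s) (x s t)
  timeConsistent : ∀ s u t, s ≤ u → u ≤ t → ∀ X : L t, x s t X = x s u (x u t X)
  rightContinuous : ∀ s t, s ≤ t → ∀ X : L t, ∀ r : ℕ → Times T,
    Antitone r → (∀ n, s < r n ∧ r n ≤ t) → Tendsto r atTop (𝓝 s) →
    ∀ᵐ ω ∂P, Tendsto (fun n => (x (r n) t X : Lp ℝ ∞ P) ω) atTop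
      (𝓝 ((x s t X : Lp ℝ ∞ P) ω))

/-- A family `d s t ∈ L_1(𝓕 t)`, `s ≤ t`, that is multiplicative in time and satisfies
`d t t' → d t t = 1` for `t' ↓ t`, in probability. -/
structure IsDensityFamily {T : ℝ} (P : Measure Ω) (𝓕 : Filtration (Times T) mΩ)
    (d : Times T → Times T → Ω → ℝ) : Prop where
  integrable : ∀ s t, s ≤ t → Integrable (d s t) P
  measurable : ∀ s t, s ≤ t → AEStronglyMeasurable[𝓕 t] (d s t) P
  multiplicative : ∀ r s t, r ≤ s → s ≤ t → (fun ω => d r s ω * d s t ω) =ᵐ[P] d r t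
  diagonal : ∀ t, d t t =ᵐ[P] fun _ => 1
  rightContinuous : ∀ t, TendstoInMeasure P (fun t' => d t t') (𝓝[>] t) (fun _ => 1)

/-- The sandwich condition: `E[m s t * Z | 𝓕 s] + x s t X ≤ E[M s t * Y | 𝓕 s]` for all
`X ∈ L t` and `Y, Z ∈ L_∞^+(𝓕 t)` with `Z + X ≤ Y`. -/
def Sandwich {T : ℝ} (P : Measure Ω) (𝓕 : Filtration (Times T) mΩ)
    (m M : Times T → Times T → Ω → ℝ) (L : Times T → Submodule ℝ (Lp ℝ ∞ P))
    (x : ∀ s t : Times T, L t → L s) : Prop :=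
  ∀ s t, s ≤ t → ∀ (X : L t) (Y Z : Lp ℝ ∞ P), MemLinftyPos P (𝓕 t) Y → MemLinftyPos P (𝓕 t) Z →
    Z + (X : Lp ℝ ∞ P) ≤ Y →
    ∀ᵐ ω ∂P, densityOp P (𝓕 s) (m s t) Z ω + (x s t X : Lp ℝ ∞ P) ω
      ≤ densityOp P (𝓕 s) (M s t) Y ω

end

end PricingBounds

/-! Taking `Y = X⁺` and `Z = X⁻` in the sandwich condition gives `x_st(X) ≤ E[max(M_st X, m_st X) |
𝓕_s]`. The right side is the upper envelope of `E[h X | 𝓕_s]` over all densities `m_st ≤ h ≤ M_st`.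
After localization to events of `𝓕_s` and integration, this says that a real functional is dominated
by a sublinear one. Hahn–Banach in Mazur–Orlicz form and Riesz representation then yield one `h` in
this interval that reproduces the price operator (`exists_density_of_le_condExp_max`).

On a finite grid of times, one-step densities are multiplied, backwards from `T`. Time consistency
makes the product price correctly between all grid times, and multiplicativity of `m` and `M` keeps
it between `m_0T` and `M_0T` once `0` is in the grid (`exists_isGridDensity`).

This order interval of `L¹` is the same for all grids and is weakly compact
(`exists_tendsto_integral_mul_of_ultrafilter`). Hence the grid densities converge weakly along an
ultrafilter of finite sets of times that eventually contain any given time. Pricing and bounds are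
linear in `f`, so they pass to the limit (`exists_isGridDensity_univ`). Since `m > 0`, conditional
densities are positive and division is legitimate at the end. -/

namespace PricingBounds

/-! ### Hahn–Banach, densities between two bounds, and weak compactness. -/

section Density

/-- **Mazur–Orlicz theorem** for linear maps: a linear functional `τ` on `V` that is dominated by
`p ∘ A`, with `p` sublinear, factors through a linear functional dominated by `p`. -/
theorem exists_linearMap_comp_eq_of_le_sublinear {V E : Type*} [AddCommGroup V] [Module ℝ V]
    [AddCommGroup E] [Module ℝ E] (A : V →ₗ[ℝ] E) (τ : V →ₗ[ℝ] ℝ) (p : E → ℝ)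
    (p_hom : ∀ c : ℝ, 0 < c → ∀ x, p (c • x) = c * p x) (p_add : ∀ x y, p (x + y) ≤ p x + p y)
    (h : ∀ v, τ v ≤ p (A v)) :
    ∃ φ : E →ₗ[ℝ] ℝ, (∀ v, φ (A v) = τ v) ∧ ∀ x, φ x ≤ p x := by
  have p_zero : p 0 = 0 := by
    have := p_hom 2 two_pos 0
    rw [smul_zero] at this
    linarith
  have hker : LinearMap.ker A ≤ LinearMap.ker τ := by
    intro v hv
    rw [LinearMap.mem_ker] at hv ⊢
    have h1 := h v
    have h2 := h (-v)
    rw [map_neg, map_neg, hv, neg_zero, p_zero] at h2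
    rw [hv, p_zero] at h1
    linarith
  -- `τ` vanishes on `ker A`, so it descends to `range A`. There it is dominated by `p`, and
  -- Hahn–Banach extends it.
  obtain ⟨σ, hσ⟩ := LinearMap.exists_extend (p := LinearMap.range A)
    (((LinearMap.ker A).liftQ τ hker) ∘ₗ A.quotKerEquivRange.symm.toLinearMap)
  have hσA : ∀ v, σ (A v) = τ v := by
    intro v
    have := LinearMap.congr_fun hσ ⟨A v, LinearMap.mem_range_self A v⟩
    simp only [LinearMap.comp_apply, Submodule.subtype_apply, LinearEquiv.coe_coe] at this
    rw [this, LinearMap.quotKerEquivRange_symm_apply_image A v (LinearMap.mem_range_self A v)]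
    simp
  obtain ⟨φ, hφ, hφp⟩ := exists_extension_of_le_sublinear
    (⟨LinearMap.range A, σ ∘ₗ (LinearMap.range A).subtype⟩ : E →ₗ.[ℝ] ℝ) p p_hom p_add (by
      rintro ⟨_, v, rfl⟩
      exact (hσA v).trans_le (h v))
  exact ⟨φ, fun v => (hφ ⟨A v, LinearMap.mem_range_self A v⟩).trans (hσA v), hφp⟩

/-- A linear functional on `L²` that is dominated by the `L¹` norm of a finite measure is
represented by an `L²` function. -/
theorem exists_integral_eq_of_le_integral_abs {Ω : Type*} {mΩ : MeasurableSpace Ω} (ν : Measure Ω)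
    [IsFiniteMeasure ν] (φ : Lp ℝ 2 ν →ₗ[ℝ] ℝ) (hφ : ∀ W, φ W ≤ ∫ ω, |W ω| ∂ν) :
    ∃ g : Lp ℝ 2 ν, ∀ W : Lp ℝ 2 ν, φ W = ∫ ω, g ω * W ω ∂ν := by
  have hbound : ∀ W : Lp ℝ 2 ν, φ W ≤ (ν Set.univ ^ (1 / 2 : ℝ)).toReal * ‖W‖ := by
    intro W
    have h1 : MemLp W 1 ν := (Lp.memLp W).mono_exponent (by norm_num)
    have hle := eLpNorm_le_eLpNorm_mul_rpow_measure_univ (μ := ν) (p := 1) (q := 2)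
      (by norm_num) (Lp.aestronglyMeasurable W)
    have hexp : (1 / (1 : ℝ≥0∞).toReal - 1 / (2 : ℝ≥0∞).toReal : ℝ) = 1 / 2 := by norm_num
    rw [hexp] at hle
    have hint : ∫ ω, |W ω| ∂ν = (eLpNorm W 1 ν).toReal := by
      rw [eLpNorm_one_eq_lintegral_enorm, ← integral_norm_eq_lintegral_enorm h1.1]
      rfl
    refine (hφ W).trans ?_
    rw [hint, Lp.norm_def, mul_comm, ← ENNReal.toReal_mul]
    exact ENNReal.toReal_mono (ENNReal.mul_ne_top (Lp.memLp W).2.ne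
      (ENNReal.rpow_ne_top_of_nonneg (by norm_num) (measure_ne_top _ _))) hle
  let Φ : Lp ℝ 2 ν →L[ℝ] ℝ := φ.mkContinuous _ (fun W => by
    rw [Real.norm_eq_abs, abs_le]
    constructor
    · have := hbound (-W)
      rw [map_neg, norm_neg] at this
      linarith
    · exact hbound W)
  -- On a finite measure the `L¹` norm is dominated by the `L²` norm, so the functional is
  -- continuous and Riesz applies.
  refine ⟨(InnerProductSpace.toDual ℝ (Lp ℝ 2 ν)).symm Φ, fun W => ?_⟩
  have h := InnerProductSpace.toDual_symm_apply (𝕜 := ℝ) (x := W) (y := Φ)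
  rw [L2.inner_def] at h
  change Φ W = _
  rw [← h]
  refine integral_congr_ae (.of_forall fun ω => ?_)
  simp [mul_comm]

variable {Ω : Type*} {mΩ : MeasurableSpace Ω} {P : Measure Ω}

theorem integrable_mul_of_memLp_top {f W : Ω → ℝ} (hf : Integrable f P) (hW : MemLp W ∞ P) :
    Integrable (fun ω => f ω * W ω) P :=
  (hf.mul_of_top_left hW : _)

/-- A linear functional on a space of bounded functions that is dominated by
`W ↦ ∫ max (M W) (m W)` is represented by a density between `m` and `M`. -/
theorem exists_density_of_le_integral_max [IsFiniteMeasure P] {m M : Ω → ℝ}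
    (hm : Integrable m P) (hM : Integrable M P) (hmM : m ≤ᵐ[P] M)
    {V : Type*} [AddCommGroup V] [Module ℝ V] (A : V →ₗ[ℝ] (Ω → ℝ)) (hA : ∀ v, MemLp (A v) ∞ P)
    (τ : V →ₗ[ℝ] ℝ) (hτ : ∀ v, τ v ≤ ∫ ω, max (M ω * A v ω) (m ω * A v ω) ∂P) :
    ∃ f : Ω → ℝ, Integrable f P ∧ m ≤ᵐ[P] f ∧ f ≤ᵐ[P] M ∧ ∀ v, τ v = ∫ ω, f ω * A v ω ∂P := by
  -- The bounds are only integrable, so they serve as a weight: under `ν = N P` the envelope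
  -- functional is dominated by the `L¹(ν)` norm, and the Hilbert space `L²(ν)` contains the bounded
  -- functions. The summand `1` makes `ν` and `P` equivalent.
  set N : Ω → ℝ := fun ω => |M ω| + |m ω| + 1 with hN
  have hNint : Integrable N P := (hM.abs.add hm.abs).add (integrable_const 1)
  have hNpos : ∀ ω, 0 < N ω := fun ω => by positivity
  have hNmeas : AEMeasurable (fun ω => ENNReal.ofReal (N ω)) P := hNint.aemeasurable.ennreal_ofReal
  have hNtop : ∀ᵐ ω ∂P, ENNReal.ofReal (N ω) < ∞ := .of_forall fun _ => ENNReal.ofReal_lt_top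
  set ν : Measure Ω := P.withDensity fun ω => ENNReal.ofReal (N ω) with hν
  have : IsFiniteMeasure ν := isFiniteMeasure_withDensity_ofReal hNint.2
  have hνP : ν ≪ P := withDensity_absolutelyContinuous _ _
  have hPν : P ≪ ν := withDensity_absolutelyContinuous' hNmeas
    (.of_forall fun ω => by simpa using hNpos ω)
  have hνint : ∀ g : Ω → ℝ, ∫ ω, g ω ∂ν = ∫ ω, N ω * g ω ∂P := fun g => by
    rw [hν, integral_withDensity_eq_integral_toReal_smul₀ hNmeas hNtop]
    simp [ENNReal.toReal_ofReal (hNpos _).le]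
  have hνI : ∀ g : Ω → ℝ, Integrable g ν ↔ Integrable (fun ω => N ω * g ω) P := fun g => by
    rw [hν, integrable_withDensity_iff_integrable_smul₀' hNmeas hNtop]
    simp [ENNReal.toReal_ofReal (hNpos _).le]
  have hW1 : ∀ W : Lp ℝ 2 ν, Integrable W ν := fun W =>
    (memLp_one_iff_integrable).1 ((Lp.memLp W).mono_exponent (by norm_num))
  have hWN : ∀ W : Lp ℝ 2 ν, Integrable (fun ω => N ω * W ω) P := fun W => (hνI _).1 (hW1 W)
  have hWP : ∀ W : Lp ℝ 2 ν, AEStronglyMeasurable W P := fun W =>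
    (Lp.aestronglyMeasurable W).mono_ac hPν
  have hWM : ∀ W : Lp ℝ 2 ν, Integrable (fun ω => M ω * W ω) P := fun W =>
    (hWN W).mono (hM.1.mul (hWP W)) (.of_forall fun ω => by
      simp only [norm_mul, Real.norm_eq_abs, abs_of_pos (hNpos ω)]
      gcongr
      simp only [hN]; linarith [abs_nonneg (m ω)])
  have hWm : ∀ W : Lp ℝ 2 ν, Integrable (fun ω => m ω * W ω) P := fun W =>
    (hWN W).mono (hm.1.mul (hWP W)) (.of_forall fun ω => by
      simp only [norm_mul, Real.norm_eq_abs, abs_of_pos (hNpos ω)]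
      gcongr
      simp only [hN]; linarith [abs_nonneg (M ω)])
  have hAν : ∀ v, MemLp (A v) 2 ν := fun v =>
    MemLp.mono_exponent (q := ∞) ⟨(hA v).1.mono_ac hνP, by
      have := (hA v).2
      rw [eLpNorm_exponent_top] at this ⊢
      exact (eLpNormEssSup_mono_measure _ hνP).trans_lt this⟩ le_top
  let B : V →ₗ[ℝ] Lp ℝ 2 ν :=
    { toFun := fun v => (hAν v).toLp
      map_add' := fun v w => by
        rw [← MemLp.toLp_add]; exact MemLp.toLp_congr _ _ (by rw [map_add])
      map_smul' := fun c v => by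
        rw [RingHom.id_apply, ← MemLp.toLp_const_smul]
        exact MemLp.toLp_congr _ _ (by rw [map_smul]) }
  have hB : ∀ v, B v =ᵐ[P] A v := fun v => hPν.ae_le (MemLp.coeFn_toLp (hAν v))
  let p : Lp ℝ 2 ν → ℝ := fun W => ∫ ω, max (M ω * W ω) (m ω * W ω) ∂P
  have p_int : ∀ W : Lp ℝ 2 ν, Integrable (fun ω => max (M ω * W ω) (m ω * W ω)) P :=
    fun W => (hWM W).sup (hWm W)
  obtain ⟨φ, hφτ, hφp⟩ := exists_linearMap_comp_eq_of_le_sublinear B τ p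
    (fun c hc W => by
      rw [← integral_const_mul]
      refine integral_congr_ae ?_
      filter_upwards [hPν.ae_le (Lp.coeFn_smul c W)] with ω hω
      rw [hω, Pi.smul_apply, smul_eq_mul, mul_left_comm, mul_left_comm (m ω),
        mul_max_of_nonneg _ _ hc.le])
    (fun W W' => by
      rw [← integral_add (p_int W) (p_int W')]
      refine integral_mono_ae (p_int _) ((p_int _).add (p_int _)) ?_
      filter_upwards [hPν.ae_le (Lp.coeFn_add W W')] with ω hω
      simp only [hω, Pi.add_apply, mul_add]
      exact max_add_add_le_max_add_max)
    (fun v => (hτ v).trans_eq (integral_congr_ae (by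
      filter_upwards [hB v] with ω hω
      rw [hω])))
  obtain ⟨g, hg⟩ := exists_integral_eq_of_le_integral_abs ν φ (fun W => by
    refine (hφp W).trans ?_
    rw [hνint]
    refine integral_mono_ae (p_int W) ((hνI _).1 (hW1 W).abs) (.of_forall fun ω => max_le ?_ ?_)
    · refine (le_abs_self _).trans ?_
      rw [abs_mul]
      refine mul_le_mul_of_nonneg_right ?_ (abs_nonneg _)
      simp only [hN]; linarith [abs_nonneg (m ω)]
    · refine (le_abs_self _).trans ?_
      rw [abs_mul]
      refine mul_le_mul_of_nonneg_right ?_ (abs_nonneg _)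
      simp only [hN]; linarith [abs_nonneg (M ω)])
  have hrep : ∀ W : Lp ℝ 2 ν, φ W = ∫ ω, (N ω * g ω) * W ω ∂P := fun W => by
    rw [hg, hνint]
    simp only [mul_assoc]
  -- Testing domination on `c · 1_s`: `c = -1` gives the lower bound on the density, `c = 1` the
  -- upper one.
  have hset : ∀ s, MeasurableSet s → ∀ c : ℝ,
      c * ∫ ω in s, N ω * g ω ∂P ≤ ∫ ω in s, max (M ω * c) (m ω * c) ∂P := by
    intro s hs c
    have hmem : MemLp (s.indicator fun _ => c) 2 ν := (memLp_const c).indicator hs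
    have hW : (hmem.toLp : Ω → ℝ) =ᵐ[P] s.indicator fun _ => c :=
      hPν.ae_le (MemLp.coeFn_toLp hmem)
    have h := hφp hmem.toLp
    rw [hrep] at h
    refine (le_of_eq ?_).trans (h.trans_eq ?_)
    · rw [← integral_const_mul, ← integral_indicator hs]
      refine integral_congr_ae ?_
      filter_upwards [hW] with ω hω
      rw [hω]
      by_cases h' : ω ∈ s <;> simp [h', mul_comm]
    · rw [← integral_indicator hs]
      refine integral_congr_ae ?_
      filter_upwards [hW] with ω hω
      rw [hω]
      by_cases h' : ω ∈ s <;> simp [h']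
  refine ⟨fun ω => N ω * g ω, hWN g, ?_, ?_, fun v => ?_⟩
  · refine ae_le_of_forall_setIntegral_le hm (hWN g) fun s hs _ => ?_
    have h := hset s hs (-1)
    have h' : ∫ ω in s, max (M ω * -1) (m ω * -1) ∂P = - ∫ ω in s, m ω ∂P := by
      rw [← integral_neg]
      refine integral_congr_ae (ae_restrict_of_ae ?_)
      filter_upwards [hmM] with ω hω
      rw [max_eq_right (by linarith)]; ring
    rw [h'] at h
    linarith
  · refine ae_le_of_forall_setIntegral_le (hWN g) hM fun s hs _ => ?_
    have h := hset s hs 1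
    have h' : ∫ ω in s, max (M ω * 1) (m ω * 1) ∂P = ∫ ω in s, M ω ∂P := by
      refine integral_congr_ae (ae_restrict_of_ae ?_)
      filter_upwards [hmM] with ω hω
      rw [max_eq_left (by linarith)]; ring
    rw [h'] at h
    linarith
  · rw [← hφτ, hrep]
    refine integral_congr_ae ?_
    filter_upwards [hB v] with ω hω
    rw [hω]

/-- **Weak compactness** of an order interval of `L¹`, along an ultrafilter. -/
theorem exists_tendsto_integral_mul_of_ultrafilter [IsFiniteMeasure P] {m M : Ω → ℝ}
    (hm : Integrable m P) (hM : Integrable M P) (hmM : m ≤ᵐ[P] M)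
    {ι : Type*} (U : Ultrafilter ι) (f : ι → Ω → ℝ) (hf : ∀ i, Integrable (f i) P)
    (hmf : ∀ i, m ≤ᵐ[P] f i) (hfM : ∀ i, f i ≤ᵐ[P] M) :
    ∃ g : Ω → ℝ, Integrable g P ∧ m ≤ᵐ[P] g ∧ g ≤ᵐ[P] M ∧ ∀ W : Ω → ℝ, MemLp W ∞ P →
      Tendsto (fun i => ∫ ω, f i ω * W ω ∂P) U (𝓝 (∫ ω, g ω * W ω ∂P)) := by
  let V : Submodule ℝ (Ω → ℝ) :=
    { carrier := {W | MemLp W ∞ P}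
      add_mem' := fun ha hb => ha.add hb
      zero_mem' := MemLp.zero
      smul_mem' := fun c _ ha => ha.const_smul c }
  have hle : ∀ i (W : V), ∫ ω, f i ω * W.1 ω ∂P ≤ ∫ ω, max (M ω * W.1 ω) (m ω * W.1 ω) ∂P := by
    intro i W
    refine integral_mono_ae (integrable_mul_of_memLp_top (hf i) W.2)
      ((integrable_mul_of_memLp_top hM W.2).sup (integrable_mul_of_memLp_top hm W.2)) ?_
    filter_upwards [hmf i, hfM i] with ω h1 h2
    rcases le_total 0 (W.1 ω) with h | h
    · exact le_max_of_le_left (mul_le_mul_of_nonneg_right h2 h)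
    · exact le_max_of_le_right (mul_le_mul_of_nonpos_right h1 h)
  have hlim : ∀ W : V, ∃ l, Tendsto (fun i => ∫ ω, f i ω * W.1 ω ∂P) U (𝓝 l) := by
    intro W
    obtain ⟨l, -, hl⟩ := (isCompact_Icc (a := -∫ ω, max (M ω * (-W).1 ω) (m ω * (-W).1 ω) ∂P)
      (b := ∫ ω, max (M ω * W.1 ω) (m ω * W.1 ω) ∂P)).ultrafilter_le_nhds
        (U.map fun i => ∫ ω, f i ω * W.1 ω ∂P) (by
          refine le_principal_iff.2 (mem_map.2 (Eventually.of_forall fun i => ⟨?_, hle i W⟩))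
          have := hle i (-W)
          have h' : ∫ ω, f i ω * (-W).1 ω ∂P = - ∫ ω, f i ω * W.1 ω ∂P := by
            rw [← integral_neg]
            simp
          rw [h'] at this
          linarith)
    exact ⟨l, hl⟩
  choose l hl using hlim
  -- The pointwise limit functional is linear and inherits the envelope bound, so the representation
  -- theorem supplies its density.
  let τ : V →ₗ[ℝ] ℝ :=
    { toFun := l
      map_add' := fun W W' => by
        refine tendsto_nhds_unique (hl (W + W')) (((hl W).add (hl W')).congr fun i => ?_)
        rw [← integral_add (integrable_mul_of_memLp_top (hf i) W.2)
          (integrable_mul_of_memLp_top (hf i) W'.2)]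
        simp [mul_add]
      map_smul' := fun c W => by
        refine tendsto_nhds_unique (hl (c • W)) (((hl W).const_mul c).congr fun i => ?_)
        rw [← integral_const_mul]
        simp [mul_left_comm] }
  obtain ⟨g, hg, hmg, hgM, hrep⟩ := exists_density_of_le_integral_max hm hM hmM V.subtype
    (fun W => W.2) τ (fun W => le_of_tendsto (hl W) (.of_forall fun i => hle i W))
  exact ⟨g, hg, hmg, hgM, fun W hW => (hrep ⟨W, hW⟩) ▸ hl ⟨W, hW⟩⟩

end Density

end PricingBounds

namespace PricingBounds

/-! ### A density for a single conditional price operator. -/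

section OneStep

variable {Ω : Type*} {𝓖 𝓗 mΩ : MeasurableSpace Ω} {P : Measure Ω}

/-- Indicators of events of `𝓖` commute with `P[· | 𝓖]`, so conditioning is local on such events. -/
theorem condExp_ae_eq_of_ae_eq_on {f g : Ω → ℝ} (hf : Integrable f P) (hg : Integrable g P)
    {A : Set Ω} (hA : MeasurableSet[𝓖] A) (h : ∀ᵐ ω ∂P, ω ∈ A → f ω = g ω) :
    ∀ᵐ ω ∂P, ω ∈ A → (P[f | 𝓖]) ω = (P[g | 𝓖]) ω := by
  have hind : A.indicator f =ᵐ[P] A.indicator g := by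
    filter_upwards [h] with ω hω
    by_cases hA' : ω ∈ A
    · simp [hA', hω hA']
    · simp [hA']
  filter_upwards [condExp_indicator hf hA, condExp_indicator hg hA,
    condExp_congr_ae (m := 𝓖) hind] with ω h1 h2 h3 hωA
  rw [h1, h2, Set.indicator_of_mem hωA, Set.indicator_of_mem hωA] at h3
  exact h3

/-- `f ↦ P[f * W | 𝓖]` does not change if `f` is projected on a larger σ-algebra for which `W` is
measurable. -/
theorem condExp_condExp_mul [IsFiniteMeasure P] (h𝓖 : 𝓖 ≤ 𝓗) (h𝓗 : 𝓗 ≤ mΩ) {f W : Ω → ℝ}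
    (hf : Integrable f P) (hWm : AEStronglyMeasurable[𝓗] W P)
    (hfW : Integrable (fun ω => f ω * W ω) P) :
    P[fun ω => (P[f | 𝓗]) ω * W ω | 𝓖] =ᵐ[P] P[fun ω => f ω * W ω | 𝓖] := by
  have h1 : P[fun ω => f ω * W ω | 𝓗] =ᵐ[P] fun ω => (P[f | 𝓗]) ω * W ω :=
    condExp_mul_of_aestronglyMeasurable_right hWm hfW hf
  exact (condExp_congr_ae h1.symm).trans (condExp_condExp_of_le h𝓖 h𝓗)

theorem condExp_mul_sub {f X Z : Ω → ℝ} (hf : Integrable f P)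
    (hX : MemLp X ∞ P) (hZ : MemLp Z ∞ P) (hZm : AEStronglyMeasurable[𝓖] Z P) :
    P[fun ω => f ω * (X ω - Z ω) | 𝓖] =ᵐ[P]
      fun ω => (P[fun ω => f ω * X ω | 𝓖]) ω - (P[f | 𝓖]) ω * Z ω := by
  have h1 : P[fun ω => f ω * (X ω - Z ω) | 𝓖] =ᵐ[P]
      P[(fun ω => f ω * X ω) - (fun ω => f ω * Z ω) | 𝓖] :=
    condExp_congr_ae (.of_forall fun ω => by simp [mul_sub])
  have h2 := condExp_sub (integrable_mul_of_memLp_top hf hX) (integrable_mul_of_memLp_top hf hZ) 𝓖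
  have h3 : P[fun ω => f ω * Z ω | 𝓖] =ᵐ[P] P[f | 𝓖] * Z :=
    condExp_mul_of_aestronglyMeasurable_right hZm (integrable_mul_of_memLp_top hf hZ) hf
  filter_upwards [h1, h2, h3] with ω h1 h2 h3
  rw [h1, h2, Pi.sub_apply, h3, Pi.mul_apply]

/-- A price functional that is dominated on its domain `K` by the upper envelope of the densities
between `m` and `M` is dominated on all sums of claims of `K` localized to events of `𝓖`. -/
theorem linearCombination_indicator_le_condExp_max (h𝓖 : 𝓖 ≤ mΩ) {m M : Ω → ℝ}
    (hm : Integrable m P) (hM : Integrable M P)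
    (K : Submodule ℝ (Lp ℝ ∞ P)) (y : K →ₗ[ℝ] Lp ℝ ∞ P)
    (hdom : ∀ U : K, (y U : Ω → ℝ) ≤ᵐ[P]
      P[fun ω => max (M ω * (U : Lp ℝ ∞ P) ω) (m ω * (U : Lp ℝ ∞ P) ω) | 𝓖])
    (v : (K × {A : Set Ω // MeasurableSet[𝓖] A}) →₀ ℝ) :
    MemLp (Finsupp.linearCombination ℝ
      (fun i : K × {A : Set Ω // MeasurableSet[𝓖] A} =>
        i.2.1.indicator ((i.1 : Lp ℝ ∞ P) : Ω → ℝ)) v) ∞ P ∧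
    MemLp (Finsupp.linearCombination ℝ
      (fun i : K × {A : Set Ω // MeasurableSet[𝓖] A} =>
        i.2.1.indicator ((y i.1 : Lp ℝ ∞ P) : Ω → ℝ)) v) ∞ P ∧
    ∀ U : K, ∀ᵐ ω ∂P, y U ω + (Finsupp.linearCombination ℝ
      (fun i : K × {A : Set Ω // MeasurableSet[𝓖] A} =>
        i.2.1.indicator ((y i.1 : Lp ℝ ∞ P) : Ω → ℝ)) v) ω ≤
      (P[fun ω => max
        (M ω * ((U : Lp ℝ ∞ P) ω + (Finsupp.linearCombination ℝ
          (fun i : K × {A : Set Ω // MeasurableSet[𝓖] A} =>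
            i.2.1.indicator ((i.1 : Lp ℝ ∞ P) : Ω → ℝ)) v) ω))
        (m ω * ((U : Lp ℝ ∞ P) ω + (Finsupp.linearCombination ℝ
          (fun i : K × {A : Set Ω // MeasurableSet[𝓖] A} =>
            i.2.1.indicator ((i.1 : Lp ℝ ∞ P) : Ω → ℝ)) v) ω)) | 𝓖]) ω := by
  set a := fun i : K × {A : Set Ω // MeasurableSet[𝓖] A} =>
    i.2.1.indicator ((i.1 : Lp ℝ ∞ P) : Ω → ℝ) with ha
  set b := fun i : K × {A : Set Ω // MeasurableSet[𝓖] A} =>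
    i.2.1.indicator ((y i.1 : Lp ℝ ∞ P) : Ω → ℝ) with hb
  -- The free summand `U` drives the induction. A new term `c · 1_A X` is absorbed into it: on `A`
  -- the hypothesis is used at `U + c X`, off `A` at `U`.
  induction v using Finsupp.induction with
  | zero =>
    refine ⟨by simp [MemLp.zero], by simp [MemLp.zero], fun U => ?_⟩
    filter_upwards [hdom U] with ω hω
    simpa using hω
  | single_add i c w _ _ ih =>
    obtain ⟨X, A, hA⟩ := i
    obtain ⟨ihA, ihB, ih⟩ := ih
    have hTa : Finsupp.linearCombination ℝ a (Finsupp.single (X, ⟨A, hA⟩) c + w) =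
        c • A.indicator ((X : Lp ℝ ∞ P) : Ω → ℝ) + Finsupp.linearCombination ℝ a w := by
      simp [ha]
    have hTb : Finsupp.linearCombination ℝ b (Finsupp.single (X, ⟨A, hA⟩) c + w) =
        c • A.indicator ((y X : Lp ℝ ∞ P) : Ω → ℝ) + Finsupp.linearCombination ℝ b w := by
      simp [hb]
    have hAm : MemLp (c • A.indicator ((X : Lp ℝ ∞ P) : Ω → ℝ)) ∞ P :=
      ((Lp.memLp (X : Lp ℝ ∞ P)).indicator (h𝓖 A hA)).const_smul c
    have hint : ∀ (U : K) (W : Ω → ℝ), MemLp W ∞ P → Integrable (fun ω =>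
        max (M ω * ((U : Lp ℝ ∞ P) ω + W ω)) (m ω * ((U : Lp ℝ ∞ P) ω + W ω))) P := fun U W hW =>
      (integrable_mul_of_memLp_top hM ((Lp.memLp (U : Lp ℝ ∞ P)).add hW)).sup
        (integrable_mul_of_memLp_top hm ((Lp.memLp (U : Lp ℝ ∞ P)).add hW))
    rw [hTa, hTb]
    refine ⟨hAm.add ihA,
      (((Lp.memLp (y X)).indicator (h𝓖 A hA)).const_smul c).add ihB, fun U => ?_⟩
    have hcoeX : ((U + c • X : K) : Lp ℝ ∞ P) =ᵐ[P]
        fun ω => (U : Lp ℝ ∞ P) ω + c * (X : Lp ℝ ∞ P) ω := by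
      filter_upwards [Lp.coeFn_add (U : Lp ℝ ∞ P) (c • X : Lp ℝ ∞ P),
        Lp.coeFn_smul c (X : Lp ℝ ∞ P)] with ω h1 h2
      rw [Submodule.coe_add, Submodule.coe_smul, h1, Pi.add_apply, h2]; rfl
    have hcoey : (y (U + c • X) : Ω → ℝ) =ᵐ[P] fun ω => y U ω + c * y X ω := by
      rw [map_add, map_smul]
      filter_upwards [Lp.coeFn_add (y U) (c • y X), Lp.coeFn_smul c (y X)] with ω h1 h2
      rw [h1, Pi.add_apply, h2]; rfl
    have hon := condExp_ae_eq_of_ae_eq_on (𝓖 := 𝓖) (A := A) (hint (U + c • X) _ ihA)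
      (hint U _ (hAm.add ihA)) hA (by
        filter_upwards [hcoeX] with ω hω hωA
        simp only [hω, Pi.add_apply, Pi.smul_apply, Set.indicator_of_mem hωA, smul_eq_mul,
          add_assoc])
    have hoff := condExp_ae_eq_of_ae_eq_on (𝓖 := 𝓖) (A := Aᶜ) (hint U _ ihA)
      (hint U _ (hAm.add ihA)) hA.compl (.of_forall fun ω hωA => by
        simp only [Pi.add_apply, Pi.smul_apply,
          Set.indicator_of_notMem (show ω ∉ A from hωA), smul_zero, zero_add])
    filter_upwards [ih (U + c • X), ih U, hon, hoff, hcoey] with ω h1 h2 h3 h4 h5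
    by_cases hωA : ω ∈ A
    · rw [← h3 hωA]
      refine (le_of_eq ?_).trans h1
      simp only [h5, Pi.add_apply, Pi.smul_apply, Set.indicator_of_mem hωA, smul_eq_mul, add_assoc]
    · rw [← h4 hωA]
      refine (le_of_eq ?_).trans h2
      simp [hωA]

/-- **Sandwich extension**: a price functional dominated by the upper envelope of the densities
between `m` and `M` is a conditional expectation with such a density. -/
theorem exists_density_of_le_condExp_max [IsFiniteMeasure P] (h𝓖 : 𝓖 ≤ 𝓗) (h𝓗 : 𝓗 ≤ mΩ) {m M : Ω → ℝ}
    (hm : Integrable m P) (hM : Integrable M P) (hmm : AEStronglyMeasurable[𝓗] m P)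
    (hMm : AEStronglyMeasurable[𝓗] M P) (hmM : m ≤ᵐ[P] M)
    (K : Submodule ℝ (Lp ℝ ∞ P)) (hK : ∀ U ∈ K, AEStronglyMeasurable[𝓗] U P)
    (y : K →ₗ[ℝ] Lp ℝ ∞ P) (hy : ∀ U, AEStronglyMeasurable[𝓖] (y U) P)
    (hdom : ∀ U : K, (y U : Ω → ℝ) ≤ᵐ[P]
      P[fun ω => max (M ω * (U : Lp ℝ ∞ P) ω) (m ω * (U : Lp ℝ ∞ P) ω) | 𝓖]) :
    ∃ h : Ω → ℝ, Integrable h P ∧ StronglyMeasurable[𝓗] h ∧ m ≤ᵐ[P] h ∧ h ≤ᵐ[P] M ∧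
      ∀ U : K, P[fun ω => h ω * (U : Lp ℝ ∞ P) ω | 𝓖] =ᵐ[P] y U := by
  have h𝓖Ω := h𝓖.trans h𝓗
  set a := fun i : K × {A : Set Ω // MeasurableSet[𝓖] A} =>
    i.2.1.indicator ((i.1 : Lp ℝ ∞ P) : Ω → ℝ) with ha
  set b := fun i : K × {A : Set Ω // MeasurableSet[𝓖] A} =>
    i.2.1.indicator ((y i.1 : Lp ℝ ∞ P) : Ω → ℝ) with hb
  have key := linearCombination_indicator_le_condExp_max h𝓖Ω hm hM K y hdom
  rw [← ha, ← hb] at key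
  have hbI : ∀ v, Integrable (Finsupp.linearCombination ℝ b v) P := fun v =>
    (key v).2.1.integrable le_top
  -- Formal combinations are used because a localized claim may have several representations; that
  -- the price is independent of the choice is part of what Mazur–Orlicz delivers.
  let τ : ((K × {A : Set Ω // MeasurableSet[𝓖] A}) →₀ ℝ) →ₗ[ℝ] ℝ :=
    { toFun := fun v => ∫ ω, Finsupp.linearCombination ℝ b v ω ∂P
      map_add' := fun v w => by
        rw [map_add, ← integral_add (hbI v) (hbI w)]; rfl
      map_smul' := fun c v => by
        rw [map_smul, RingHom.id_apply, smul_eq_mul, ← integral_const_mul]; rfl }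
  obtain ⟨f, hf, hmf, hfM, hrep⟩ := exists_density_of_le_integral_max hm hM hmM
    (Finsupp.linearCombination ℝ a) (fun v => (key v).1) τ (fun v => by
      rw [← integral_condExp h𝓖Ω]
      refine integral_mono_ae (hbI v) integrable_condExp ?_
      filter_upwards [(key v).2.2 0, Lp.coeFn_zero ℝ ∞ P,
        condExp_congr_ae (m := 𝓖) (μ := P) (f := fun ω => max
          (M ω * (((0 : K) : Lp ℝ ∞ P) ω + (Finsupp.linearCombination ℝ a v) ω))
          (m ω * (((0 : K) : Lp ℝ ∞ P) ω + (Finsupp.linearCombination ℝ a v) ω)))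
          (g := fun ω => max (M ω * (Finsupp.linearCombination ℝ a v) ω)
            (m ω * (Finsupp.linearCombination ℝ a v) ω)) (by
          filter_upwards [Lp.coeFn_zero ℝ ∞ P] with ω hω
          rw [Submodule.coe_zero, hω, Pi.zero_apply, zero_add])] with ω h1 h2 h3
      rw [map_zero, h2, Pi.zero_apply, zero_add] at h1
      exact h1.trans_eq h3)
  have hfU : ∀ U : K, Integrable (fun ω => f ω * (U : Lp ℝ ∞ P) ω) P := fun U =>
    integrable_mul_of_memLp_top hf (Lp.memLp _)
  -- Projecting `f` on `𝓗` loses nothing, since the bounds and the claims are `𝓗`-measurable.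
  refine ⟨P[f | 𝓗], integrable_condExp, stronglyMeasurable_condExp, ?_, ?_, fun U => ?_⟩
  · exact (condExp_of_aestronglyMeasurable' h𝓗 hmm hm).symm.le.trans (condExp_mono hm hf hmf)
  · exact (condExp_mono hf hM hfM).trans (condExp_of_aestronglyMeasurable' h𝓗 hMm hM).le
  · refine (condExp_condExp_mul h𝓖 h𝓗 hf (hK U U.2) (hfU U)).trans ?_
    refine (ae_eq_condExp_of_forall_setIntegral_eq h𝓖Ω (hfU U)
      (fun s _ _ => ((Lp.memLp (y U)).integrable le_top).integrableOn) (fun A hA _ => ?_)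
      (hy U)).symm
    have h := hrep (Finsupp.single (U, ⟨A, hA⟩) 1)
    simp only [τ, LinearMap.coe_mk, AddHom.coe_mk, Finsupp.linearCombination_single, one_smul, ha,
      hb] at h
    rw [integral_indicator (h𝓖Ω A hA)] at h
    rw [h, ← integral_indicator (h𝓖Ω A hA)]
    refine integral_congr_ae (.of_forall fun ω => ?_)
    by_cases hω : ω ∈ A <;> simp [hω]

end OneStep

end PricingBounds

namespace PricingBounds

/-! ### Densities on finite grids of times. -/

section Grid

variable {Ω : Type*} {mΩ : MeasurableSpace Ω} {P : Measure Ω} [IsProbabilityMeasure P] {T : ℝ}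
  {𝓕 : Filtration (Times T) mΩ} {m M : Times T → Times T → Ω → ℝ}
  {L : Times T → Submodule ℝ (Lp ℝ ∞ P)} {x : ∀ s t : Times T, L t → L s}

theorem one_ae_eq : (one P : Ω → ℝ) =ᵐ[P] fun _ => 1 := Lp.coeFn_const _ _ _

theorem IsPriceOperator.map_neg {𝓖 : MeasurableSpace Ω} {Lt Ls : Submodule ℝ (Lp ℝ ∞ P)}
    {y : Lt → Ls} (hy : IsPriceOperator P 𝓖 Lt Ls y) (X : Lt) : y (-X) = -y X := by
  have h0 : y 0 = 0 := by
    have := hy.additive 0 0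
    rw [add_zero] at this
    exact left_eq_add.1 this
  have := hy.additive X (-X)
  rw [add_neg_cancel, h0] at this
  exact (neg_eq_of_add_eq_zero_right this.symm).symm

/-- Homogeneity covers non-negative constants; additivity supplies the sign. -/
theorem IsPriceOperator.map_smul {𝓖 : MeasurableSpace Ω} {Lt Ls : Submodule ℝ (Lp ℝ ∞ P)}
    {y : Lt → Ls} (hy : IsPriceOperator P 𝓖 Lt Ls y) (c : ℝ) (X : Lt) : y (c • X) = c • y X := by
  have hpos : ∀ c : ℝ, 0 ≤ c → ∀ X : Lt, y (c • X) = c • y X := by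
    intro c hc X
    have hl : (Lp.const ∞ P c : Ω → ℝ) =ᵐ[P] fun _ => c := Lp.coeFn_const _ _ _
    have h := hy.homogeneous X (c • X) (Lp.const ∞ P c)
      ⟨(stronglyMeasurable_const (b := c)).aestronglyMeasurable.congr hl.symm, by
        rw [← Lp.coeFn_nonneg]
        filter_upwards [hl] with ω hω
        rw [hω]; exact hc⟩
      (by
        rw [Submodule.coe_smul]
        filter_upwards [hl, Lp.coeFn_smul c (X : Lp ℝ ∞ P)] with ω h1 h2
        rw [h1, h2]; rfl)
    refine Subtype.ext (Lp.ext ?_)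
    rw [Submodule.coe_smul]
    filter_upwards [h, hl, Lp.coeFn_smul c (y X : Lp ℝ ∞ P)] with ω h1 h2 h3
    rw [h1, h2, h3]; rfl
  rcases le_total 0 c with hc | hc
  · exact hpos c hc X
  · have h := hpos (-c) (neg_nonneg.2 hc) (-X)
    rwa [neg_smul_neg, hy.map_neg, neg_smul_neg] at h

/-- A price operator as a linear map into `L_∞`. -/
def IsPriceOperator.toLinearMap {𝓖 : MeasurableSpace Ω} {Lt Ls : Submodule ℝ (Lp ℝ ∞ P)}
    {y : Lt → Ls} (hy : IsPriceOperator P 𝓖 Lt Ls y) : Lt →ₗ[ℝ] Lp ℝ ∞ P where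
  toFun X := y X
  map_add' X Y := by rw [hy.additive]; rfl
  map_smul' c X := by rw [hy.map_smul]; rfl

theorem IsMarket.aestronglyMeasurable (hL : IsMarket P 𝓕 L) {t : Times T} (X : L t) :
    AEStronglyMeasurable[𝓕 t] (X : Lp ℝ ∞ P) P :=
  mem_lpMeas_iff_aestronglyMeasurable.1 (hL.measurable t X.2)

/-- The choice `Y = X⁺`, `Z = X⁻` turns the sandwich into an envelope bound, because `M X⁺ - m X⁻ =
max (M X) (m X)` when `m ≤ M`. -/
theorem Sandwich.le_condExp_max (hsand : Sandwich P 𝓕 m M L x) (hL : IsMarket P 𝓕 L)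
    (hm : IsDensityFamily P 𝓕 m) (hM : IsDensityFamily P 𝓕 M)
    (hmM : ∀ s t, s ≤ t → ∀ᵐ ω ∂P, 0 < m s t ω ∧ m s t ω ≤ M s t ω)
    {s t : Times T} (hst : s ≤ t) (X : L t) :
    ((x s t X : Lp ℝ ∞ P) : Ω → ℝ) ≤ᵐ[P] P[fun ω => max (M s t ω * (X : Lp ℝ ∞ P) ω)
      (m s t ω * (X : Lp ℝ ∞ P) ω) | 𝓕 s] := by
  set U : Lp ℝ ∞ P := X.1 with hU
  have hp : ((U ⊔ 0 : Lp ℝ ∞ P) : Ω → ℝ) =ᵐ[P] fun ω => max (U ω) 0 := by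
    filter_upwards [Lp.coeFn_sup U 0, Lp.coeFn_zero ℝ ∞ P] with ω h1 h2
    rw [h1, Pi.sup_apply, h2]; rfl
  have hn : ((-U ⊔ 0 : Lp ℝ ∞ P) : Ω → ℝ) =ᵐ[P] fun ω => max (-U ω) 0 := by
    filter_upwards [Lp.coeFn_sup (-U) 0, Lp.coeFn_zero ℝ ∞ P, Lp.coeFn_neg U] with ω h1 h2 h3
    rw [h1, Pi.sup_apply, h2, h3]; rfl
  have hUm : AEStronglyMeasurable[𝓕 t] U P := hL.aestronglyMeasurable X
  have h := hsand s t hst X (U ⊔ 0) (-U ⊔ 0)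
    ⟨((continuous_id.max continuous_const).comp_aestronglyMeasurable hUm).congr hp.symm, le_sup_right⟩
    ⟨((continuous_neg.max continuous_const).comp_aestronglyMeasurable hUm).congr hn.symm, le_sup_right⟩
    (by
      rw [← Lp.coeFn_le]
      filter_upwards [hp, hn, Lp.coeFn_add (-U ⊔ 0) U] with ω h1 h2 h3
      rw [h3, Pi.add_apply, h1, h2]
      rcases le_total 0 (U ω) with h | h
      · rw [max_eq_left h, max_eq_right (neg_nonpos.2 h), zero_add]
      · rw [max_eq_right h, max_eq_left (neg_nonneg.2 h), neg_add_cancel])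
  have hMI := integrable_mul_of_memLp_top (hM.integrable s t hst) (Lp.memLp (U ⊔ 0))
  have hmI := integrable_mul_of_memLp_top (hm.integrable s t hst) (Lp.memLp (-U ⊔ 0))
  have hsub := condExp_sub hMI hmI (𝓕 s)
  have hcongr : P[fun ω => max (M s t ω * U ω) (m s t ω * U ω) | 𝓕 s] =ᵐ[P]
      P[(fun ω => M s t ω * (U ⊔ 0 : Lp ℝ ∞ P) ω) -
        fun ω => m s t ω * (-U ⊔ 0 : Lp ℝ ∞ P) ω | 𝓕 s] := by
    refine condExp_congr_ae ?_
    filter_upwards [hp, hn, hmM s t hst] with ω h1 h2 h3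
    rw [Pi.sub_apply, h1, h2]
    rcases le_total 0 (U ω) with h | h
    · rw [max_eq_left h, max_eq_right (neg_nonpos.2 h),
        max_eq_left (mul_le_mul_of_nonneg_right h3.2 h)]; ring
    · rw [max_eq_right h, max_eq_left (neg_nonneg.2 h),
        max_eq_right (mul_le_mul_of_nonpos_right h3.2 h)]; ring
  filter_upwards [h, hsub, hcongr] with ω h1 h2 h3
  rw [h3, h2, Pi.sub_apply]
  simp only [densityOp] at h1
  linarith

/-- For equal times both bounds are `1`, so the envelope bound reads `x_tt(X) ≤ X`; applying it to
`-X` gives equality. -/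
theorem IsPriceFamily.diagonal (hx : IsPriceFamily P 𝓕 L x) (hsand : Sandwich P 𝓕 m M L x)
    (hL : IsMarket P 𝓕 L) (hm : IsDensityFamily P 𝓕 m) (hM : IsDensityFamily P 𝓕 M)
    (hmM : ∀ s t, s ≤ t → ∀ᵐ ω ∂P, 0 < m s t ω ∧ m s t ω ≤ M s t ω) (t : Times T) (X : L t) :
    x t t X = X := by
  have hle : ∀ X : L t, ((x t t X : Lp ℝ ∞ P) : Ω → ℝ) ≤ᵐ[P] (X : Lp ℝ ∞ P) := by
    intro X
    have h := condExp_of_aestronglyMeasurable' (𝓕.le t) (hL.aestronglyMeasurable X)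
      ((Lp.memLp (X : Lp ℝ ∞ P)).integrable le_top)
    have h' : P[fun ω => max (M t t ω * (X : Lp ℝ ∞ P) ω) (m t t ω * (X : Lp ℝ ∞ P) ω) | 𝓕 t]
        =ᵐ[P] P[(X : Lp ℝ ∞ P) | 𝓕 t] := by
      refine condExp_congr_ae ?_
      filter_upwards [hm.diagonal t, hM.diagonal t] with ω h1 h2
      rw [h1, h2, max_self, one_mul]
    exact (hsand.le_condExp_max hL hm hM hmM le_rfl X).trans (h'.trans h).le
  refine Subtype.ext (Lp.ext ?_)
  have hneg := hle (-X)
  rw [(hx.priceOperator t t le_rfl).map_neg] at hneg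
  filter_upwards [hle X, hneg, Lp.coeFn_neg (x t t X : Lp ℝ ∞ P),
    Lp.coeFn_neg (X : Lp ℝ ∞ P)] with ω h1 h2 h3 h4
  rw [Submodule.coe_neg, Submodule.coe_neg, h3, h4, Pi.neg_apply, Pi.neg_apply] at h2
  linarith

/-- Each price operator of the market has a density between `m s t` and `M s t`. -/
theorem IsPriceFamily.exists_density (hx : IsPriceFamily P 𝓕 L x) (hsand : Sandwich P 𝓕 m M L x)
    (hL : IsMarket P 𝓕 L) (hm : IsDensityFamily P 𝓕 m) (hM : IsDensityFamily P 𝓕 M)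
    (hmM : ∀ s t, s ≤ t → ∀ᵐ ω ∂P, 0 < m s t ω ∧ m s t ω ≤ M s t ω)
    {s t : Times T} (hst : s ≤ t) :
    ∃ h : Ω → ℝ, Integrable h P ∧ StronglyMeasurable[𝓕 t] h ∧ m s t ≤ᵐ[P] h ∧ h ≤ᵐ[P] M s t ∧
      ∀ X : L t, P[fun ω => h ω * (X : Lp ℝ ∞ P) ω | 𝓕 s] =ᵐ[P] (x s t X : Lp ℝ ∞ P) :=
  exists_density_of_le_condExp_max (𝓕.mono hst) (𝓕.le t) (hm.integrable s t hst)
    (hM.integrable s t hst) (hm.measurable s t hst) (hM.measurable s t hst)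
    ((hmM s t hst).mono fun _ h => h.2) (L t)
    (fun _ hU => mem_lpMeas_iff_aestronglyMeasurable.1 (hL.measurable t hU))
    (hx.priceOperator s t hst).toLinearMap (fun X => hL.aestronglyMeasurable (x s t X))
    (fun X => hsand.le_condExp_max hL hm hM hmM hst X)

/-- `f` is a density on `[r, u]` that represents the prices between the times of `S` and
satisfies the bounds at these times. -/
structure IsGridDensity (P : Measure Ω) [IsProbabilityMeasure P] (𝓕 : Filtration (Times T) mΩ)
    (m M : Times T → Times T → Ω → ℝ) (L : Times T → Submodule ℝ (Lp ℝ ∞ P))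
    (x : ∀ s t : Times T, L t → L s) (S : Set (Times T)) (r u : Times T) (f : Ω → ℝ) :
    Prop where
  integrable : Integrable f P
  lower : m r u ≤ᵐ[P] f
  upper : f ≤ᵐ[P] M r u
  normalized : P[f | 𝓕 r] =ᵐ[P] fun _ => 1
  -- This condition and the next are free of quotients and linear in `f`, so that they survive weak
  -- limits.
  price : ∀ s ∈ S, ∀ t ∈ S, s ≤ t → ∀ X : L t,
    P[fun ω => f ω * ((X : Lp ℝ ∞ P) ω - (x s t X : Lp ℝ ∞ P) ω) | 𝓕 s] =ᵐ[P] 0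
  bounds : ∀ s ∈ S, ∀ t ∈ S, s ≤ t → ∀ᵐ ω ∂P,
    m s t ω * (P[f | 𝓕 s]) ω ≤ (P[f | 𝓕 t]) ω ∧ (P[f | 𝓕 t]) ω ≤ M s t ω * (P[f | 𝓕 s]) ω

/-- The new density is `h * f`, with `h` a one-step density from `q` to `r`. As `h` is `𝓕
r`-measurable, it factors out at all times from `r` on, so the old relations persist. Relations
starting at `q` are composed through `r`, the least time of `S`. -/
theorem IsGridDensity.exists_insert {S : Set (Times T)} {q r u : Times T} {f : Ω → ℝ}
    (hf : IsGridDensity P 𝓕 m M L x S r u f) (hrS : r ∈ S) (hrS' : ∀ s ∈ S, r ≤ s)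
    (hqr : q ≤ r) (hru : r ≤ u)
    (hx : IsPriceFamily P 𝓕 L x) (hsand : Sandwich P 𝓕 m M L x)
    (hL : IsMarket P 𝓕 L) (hm : IsDensityFamily P 𝓕 m) (hM : IsDensityFamily P 𝓕 M)
    (hmM : ∀ s t, s ≤ t → ∀ᵐ ω ∂P, 0 < m s t ω ∧ m s t ω ≤ M s t ω) :
    ∃ f', IsGridDensity P 𝓕 m M L x (insert q S) q u f' := by
  obtain ⟨h, hhI, hhm, hmh, hhM, hhx⟩ := hx.exists_density hsand hL hm hM hmM hqr
  have hh0 : ∀ᵐ ω ∂P, 0 < h ω := by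
    filter_upwards [hmM q r hqr, hmh] with ω h1 h2 using h1.1.trans_le h2
  have hf0 : ∀ᵐ ω ∂P, 0 < f ω := by
    filter_upwards [hmM r u hru, hf.lower] with ω h1 h2 using h1.1.trans_le h2
  have hlow : m q u ≤ᵐ[P] fun ω => h ω * f ω := by
    filter_upwards [hmM q r hqr, hmM r u hru, hmh, hf.lower, hm.multiplicative q r u hqr hru]
      with ω h1 h2 h3 h4 h5
    rw [← h5]
    exact mul_le_mul h3 h4 h2.1.le (h1.1.le.trans h3)
  have hupp : (fun ω => h ω * f ω) ≤ᵐ[P] M q u := by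
    filter_upwards [hh0, hf0, hhM, hf.upper, hM.multiplicative q r u hqr hru]
      with ω h1 h2 h3 h4 h5
    rw [← h5]
    exact mul_le_mul h3 h4 h2.le (h1.le.trans h3)
  have hI : Integrable (fun ω => h ω * f ω) P :=
    (hM.integrable q u (hqr.trans hru)).mono (hhI.1.mul hf.integrable.1) (by
      filter_upwards [hh0, hf0, hupp] with ω h1 h2 h3
      rw [Real.norm_eq_abs, Real.norm_eq_abs, abs_of_pos (mul_pos h1 h2)]
      exact h3.trans (le_abs_self _))
  have hpull : ∀ s, r ≤ s → ∀ W : Ω → ℝ, MemLp W ∞ P →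
      P[fun ω => h ω * f ω * W ω | 𝓕 s] =ᵐ[P] fun ω => h ω * (P[fun ω => f ω * W ω | 𝓕 s]) ω := by
    intro s hrs W hW
    simp only [mul_assoc]
    exact condExp_mul_of_stronglyMeasurable_left (hhm.mono (𝓕.mono hrs))
      ((integrable_mul_of_memLp_top hI hW).congr (.of_forall fun ω => by simp [mul_assoc]))
      (integrable_mul_of_memLp_top hf.integrable hW)
  have hpull1 : ∀ s, r ≤ s →
      P[fun ω => h ω * f ω | 𝓕 s] =ᵐ[P] fun ω => h ω * (P[f | 𝓕 s]) ω := by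
    intro s hrs
    simpa using hpull s hrs (fun _ => 1) (memLp_const 1)
  -- Conditioning first on `𝓕 r` leaves `h · 1`, whose conditional expectation is the price of the
  -- numéraire.
  have hone : P[fun ω => h ω * f ω | 𝓕 q] =ᵐ[P] fun _ => 1 := by
    have h1 : P[fun ω => h ω * f ω | 𝓕 r] =ᵐ[P]
        fun ω => h ω * ((⟨one P, hL.one_mem r⟩ : L r) : Lp ℝ ∞ P) ω := by
      filter_upwards [hpull1 r le_rfl, hf.normalized, one_ae_eq (P := P)] with ω h1 h2 h3
      rw [h1, h2, h3]
    refine (condExp_condExp_of_le (𝓕.mono hqr) (𝓕.le r)).symm.trans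
      ((condExp_congr_ae h1).trans ((hhx _).trans ?_))
    rw [(hx.priceOperator q r hqr).map_one _ rfl]
    exact one_ae_eq
  have hprice : ∀ t ∈ S, ∀ X : L t,
      P[fun ω => h ω * f ω * (X : Lp ℝ ∞ P) ω | 𝓕 q] =ᵐ[P] (x q t X : Lp ℝ ∞ P) := by
    intro t ht X
    have hrt := hrS' t ht
    have h1 : P[fun ω => h ω * f ω * (X : Lp ℝ ∞ P) ω | 𝓕 r] =ᵐ[P]
        fun ω => h ω * (x r t X : Lp ℝ ∞ P) ω := by
      filter_upwards [hpull r le_rfl _ (Lp.memLp (X : Lp ℝ ∞ P)), hf.price r hrS t ht hrt X,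
        hf.normalized, condExp_mul_sub hf.integrable (Lp.memLp (X : Lp ℝ ∞ P))
          (Lp.memLp (x r t X : Lp ℝ ∞ P)) (hL.aestronglyMeasurable (x r t X))]
        with ω h1 h2 h3 h4
      rw [h4, h3, one_mul, Pi.zero_apply, sub_eq_zero] at h2
      rw [h1, h2]
    rw [hx.timeConsistent q r t hqr hrt X]
    exact (condExp_condExp_of_le (𝓕.mono hqr) (𝓕.le r)).symm.trans
      ((condExp_congr_ae h1).trans (hhx _))
  have hdiag : ∀ X : L q, P[fun ω => h ω * f ω *
      ((X : Lp ℝ ∞ P) ω - (x q q X : Lp ℝ ∞ P) ω) | 𝓕 q] =ᵐ[P] 0 := by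
    intro X
    rw [hx.diagonal hsand hL hm hM hmM]
    simp only [sub_self, mul_zero]
    exact (condExp_const (𝓕.le q) (0 : ℝ)).eventuallyEq
  have hbdiag : ∀ᵐ ω ∂P,
      m q q ω * (P[fun ω => h ω * f ω | 𝓕 q]) ω ≤ (P[fun ω => h ω * f ω | 𝓕 q]) ω ∧
      (P[fun ω => h ω * f ω | 𝓕 q]) ω ≤ M q q ω * (P[fun ω => h ω * f ω | 𝓕 q]) ω := by
    filter_upwards [hm.diagonal q, hM.diagonal q] with ω h1 h2
    rw [h1, h2, one_mul]
    exact ⟨le_rfl, le_rfl⟩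
  refine ⟨fun ω => h ω * f ω, hI, hlow, hupp, hone, ?_, ?_⟩
  · rintro s (rfl | hs) t (rfl | ht) hst X
    · exact hdiag X
    · filter_upwards [condExp_mul_sub hI (Lp.memLp (X : Lp ℝ ∞ P))
        (Lp.memLp (x s t X : Lp ℝ ∞ P)) (hL.aestronglyMeasurable (x s t X)),
        hprice t ht X, hone] with ω h1 h2 h3
      rw [h1, h2, h3, one_mul, sub_self]; rfl
    -- Here `s ∈ S` precedes `q`, while `q ≤ r ≤ s`; so the two times coincide.
    · obtain rfl := le_antisymm hst (hqr.trans (hrS' s hs))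
      exact hdiag X
    · filter_upwards [hpull s (hrS' s hs) _ ((Lp.memLp (X : Lp ℝ ∞ P)).sub
        (Lp.memLp (x s t X : Lp ℝ ∞ P))), hf.price s hs t ht hst X] with ω h1 h2
      simp only [Pi.sub_apply] at h1
      rw [h1, h2, Pi.zero_apply, mul_zero]
  · rintro s (rfl | hs) t (rfl | ht) hst
    · exact hbdiag
    · have hrt := hrS' t ht
      filter_upwards [hone, hpull1 t hrt, hf.bounds r hrS t ht hrt, hf.normalized, hh0, hmh, hhM,
        hm.multiplicative s r t hqr hrt, hM.multiplicative s r t hqr hrt, hmM r t hrt]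
        with ω h1 h2 h3 h4 h5 h6 h7 h8 h9 h10
      rw [h4, mul_one, mul_one] at h3
      rw [h1, h2, mul_one, mul_one, ← h8, ← h9]
      exact ⟨mul_le_mul h6 h3.1 h10.1.le h5.le,
        mul_le_mul h7 h3.2 (h10.1.le.trans h3.1) (h5.le.trans h7)⟩
    · obtain rfl := le_antisymm hst (hqr.trans (hrS' s hs))
      exact hbdiag
    · filter_upwards [hpull1 s (hrS' s hs), hpull1 t (hrS' t ht), hf.bounds s hs t ht hst, hh0]
        with ω h1 h2 h3 h4
      rw [h1, h2, mul_left_comm, mul_left_comm (M s t ω)]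
      exact ⟨mul_le_mul_of_nonneg_left h3.1 h4.le, mul_le_mul_of_nonneg_left h3.2 h4.le⟩

/-- Backward induction: start from the density `1` at the terminal time and insert each new minimum.
-/
theorem exists_isGridDensity {u : Times T} (hu : ∀ t, t ≤ u)
    (hx : IsPriceFamily P 𝓕 L x) (hsand : Sandwich P 𝓕 m M L x)
    (hL : IsMarket P 𝓕 L) (hm : IsDensityFamily P 𝓕 m) (hM : IsDensityFamily P 𝓕 M)
    (hmM : ∀ s t, s ≤ t → ∀ᵐ ω ∂P, 0 < m s t ω ∧ m s t ω ≤ M s t ω) (S : Finset (Times T)) :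
    ∃ r ∈ (insert u S : Set (Times T)), (∀ s ∈ (insert u S : Set (Times T)), r ≤ s) ∧
      ∃ f, IsGridDensity P 𝓕 m M L x (insert u S) r u f := by
  induction S using Finset.induction_on_min with
  | empty =>
    refine ⟨u, by simp, by simp, fun _ => 1, integrable_const 1, ?_, ?_, ?_, ?_, ?_⟩
    · exact (hm.diagonal u).le
    · exact (hM.diagonal u).symm.le
    · exact (condExp_const (𝓕.le u) (1 : ℝ)).eventuallyEq
    · intro s hs t ht _ X
      simp only [Finset.coe_empty, insert_empty_eq, Set.mem_singleton_iff] at hs ht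
      subst ht hs
      rw [hx.diagonal hsand hL hm hM hmM]
      simp only [sub_self, mul_zero]
      exact (condExp_const (𝓕.le _) (0 : ℝ)).eventuallyEq
    · intro s hs t ht _
      simp only [Finset.coe_empty, insert_empty_eq, Set.mem_singleton_iff] at hs ht
      subst ht hs
      filter_upwards [hm.diagonal s, hM.diagonal s] with ω h1 h2
      rw [h1, h2, one_mul]
      exact ⟨le_rfl, le_rfl⟩
  | insert a S ha ih =>
    obtain ⟨r, hr, hrS, f, hf⟩ := ih
    have har : a ≤ r := by
      rcases hr with rfl | hr
      · exact hu a
      · exact (ha r hr).le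
    obtain ⟨f', hf'⟩ := hf.exists_insert hr hrS har (hu r) hx hsand hL hm hM hmM
    rw [Finset.coe_insert, Set.insert_comm]
    refine ⟨a, Set.mem_insert _ _, ?_, f', hf'⟩
    rintro s (rfl | hs)
    · exact le_rfl
    · exact har.trans (hrS s hs)

end Grid

end PricingBounds

namespace PricingBounds

/-! ### Conditional inequalities under weak limits. -/

section Limit

variable {Ω : Type*} {𝓖 𝓗 mΩ : MeasurableSpace Ω} {P : Measure Ω}

theorem ae_nonneg_of_forall_setIntegral_nonneg_of_stronglyMeasurable (h𝓖 : 𝓖 ≤ mΩ) {f : Ω → ℝ}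
    (hf : Integrable f P) (hfm : StronglyMeasurable[𝓖] f)
    (h : ∀ A, MeasurableSet[𝓖] A → 0 ≤ ∫ ω in A, f ω ∂P) : 0 ≤ᵐ[P] f :=
  ae_le_of_ae_le_trim (hm := h𝓖) (ae_nonneg_of_forall_setIntegral_nonneg (hf.trim h𝓖 hfm)
    fun A hA _ => by rw [← setIntegral_trim h𝓖 hfm hA]; exact h A hA)

variable [IsFiniteMeasure P]

/-- Conditioning is self-adjoint: both sides integrate `P[f | 𝓖] * P[b | 𝓖]`. It can thus be moved
onto the bounded test function, where weak convergence applies. -/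
theorem integral_mul_condExp (h𝓖 : 𝓖 ≤ mΩ) {f b : Ω → ℝ} (hf : Integrable f P)
    (hb : MemLp b ∞ P) :
    MemLp (P[b | 𝓖]) ∞ P ∧
      ∫ ω, f ω * (P[b | 𝓖]) ω ∂P = ∫ ω, (P[f | 𝓖]) ω * b ω ∂P := by
  have hb' : MemLp (P[b | 𝓖]) ∞ P := hb.condExp le_top
  have hbI : Integrable b P := hb.integrable le_top
  refine ⟨hb', ?_⟩
  have h1 : P[fun ω => f ω * (P[b | 𝓖]) ω | 𝓖] =ᵐ[P] P[f | 𝓖] * P[b | 𝓖] :=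
    condExp_mul_of_stronglyMeasurable_right stronglyMeasurable_condExp
      (integrable_mul_of_memLp_top hf hb') hf
  have h2 : P[fun ω => (P[f | 𝓖]) ω * b ω | 𝓖] =ᵐ[P] P[f | 𝓖] * P[b | 𝓖] :=
    condExp_mul_of_stronglyMeasurable_left stronglyMeasurable_condExp
      (integrable_mul_of_memLp_top integrable_condExp hb) hbI
  rw [← integral_condExp h𝓖, ← integral_condExp h𝓖 (f := fun ω => (P[f | 𝓖]) ω * b ω)]
  exact integral_congr_ae (h1.trans h2.symm)

theorem condExp_eq_zero_of_forall_setIntegral_eq_zero (h𝓖 : 𝓖 ≤ mΩ) {f : Ω → ℝ}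
    (hf : Integrable f P) (h : ∀ A, MeasurableSet[𝓖] A → ∫ ω in A, f ω ∂P = 0) :
    P[f | 𝓖] =ᵐ[P] 0 :=
  (ae_eq_condExp_of_forall_setIntegral_eq h𝓖 hf (fun _ _ _ => integrableOn_zero)
    (fun A hA _ => by simp [h A hA]) aestronglyMeasurable_zero).symm

/-- Linear inequalities between conditional expectations are preserved under weak limits. -/
theorem add_condExp_nonneg_of_tendsto (h𝓖𝓗 : 𝓖 ≤ 𝓗) (h𝓗 : 𝓗 ≤ mΩ) {ι : Type*} {l : Filter ι}
    [l.NeBot] {f : ι → Ω → ℝ} {g : Ω → ℝ} (hf : ∀ i, Integrable (f i) P) (hg : Integrable g P)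
    (hlim : ∀ W : Ω → ℝ, MemLp W ∞ P →
      Tendsto (fun i => ∫ ω, f i ω * W ω ∂P) l (𝓝 (∫ ω, g ω * W ω ∂P)))
    (c : ℝ) {d : Ω → ℝ} (hd : AEStronglyMeasurable[𝓗] d P)
    (h : ∀ᶠ i in l, ∀ᵐ ω ∂P, 0 ≤ c * (P[f i | 𝓗]) ω + d ω * (P[f i | 𝓖]) ω) :
    ∀ᵐ ω ∂P, 0 ≤ c * (P[g | 𝓗]) ω + d ω * (P[g | 𝓖]) ω := by
  have h𝓖 := h𝓖𝓗.trans h𝓗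
  obtain ⟨d', hd', hdd'⟩ := hd
  -- The coefficient `d` need not be bounded, but weak convergence is tested on bounded functions;
  -- hence truncation.
  let B : ℕ → Set Ω := fun k => {ω | |d' ω| ≤ k}
  have hB : ∀ k, MeasurableSet[𝓗] (B k) := fun k =>
    (measurable_abs.comp hd'.measurable) measurableSet_Iic
  have hbd : ∀ (k : ℕ) (A : Set Ω), MeasurableSet[𝓗] A → MemLp ((A ∩ B k).indicator d') ∞ P := by
    intro k A hA
    refine memLp_top_of_bound ((hd'.indicator (hA.inter (hB k))).mono h𝓗).aestronglyMeasurable k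
      (.of_forall fun ω => ?_)
    by_cases hω : ω ∈ A ∩ B k
    · rw [Set.indicator_of_mem hω]; exact hω.2
    · rw [Set.indicator_of_notMem hω, norm_zero]; positivity
  have hW1 : ∀ (k : ℕ) (A : Set Ω), MeasurableSet[𝓗] A →
      MemLp ((A ∩ B k).indicator fun _ => c) ∞ P := fun k A hA =>
    (memLp_const c).indicator (h𝓗 _ (hA.inter (hB k)))
  -- By duality, integrating `f` against `W k A` gives the integral of `c P[f | 𝓗] + d' P[f | 𝓖]`
  -- over `A ∩ B k`.
  let W : ℕ → Set Ω → Ω → ℝ := fun k A ω =>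
    (A ∩ B k).indicator (fun _ => c) ω + (P[(A ∩ B k).indicator d' | 𝓖]) ω
  have hW : ∀ (k : ℕ) (A : Set Ω), MeasurableSet[𝓗] A → MemLp (W k A) ∞ P := fun k A hA =>
    (hW1 k A hA).add (integral_mul_condExp h𝓖 hg (hbd k A hA)).1
  let H : (Ω → ℝ) → Ω → ℝ := fun f ω => c * (P[f | 𝓗]) ω + d' ω * (P[f | 𝓖]) ω
  have hsplit : ∀ (f : Ω → ℝ) (k : ℕ) (A : Set Ω), (A ∩ B k).indicator (H f) =
      fun ω => (P[f | 𝓗]) ω * (A ∩ B k).indicator (fun _ => c) ω +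
        (P[f | 𝓖]) ω * (A ∩ B k).indicator d' ω := by
    intro f k A
    funext ω
    by_cases hω : ω ∈ A ∩ B k
    · simp only [Set.indicator_of_mem hω, H]; ring
    · simp only [Set.indicator_of_notMem hω]; ring
  have hI : ∀ (f : Ω → ℝ) (k : ℕ) (A : Set Ω), MeasurableSet[𝓗] A →
      Integrable ((A ∩ B k).indicator (H f)) P := by
    intro f k A hA
    rw [hsplit]
    exact (integrable_mul_of_memLp_top integrable_condExp (hW1 k A hA)).add
      (integrable_mul_of_memLp_top integrable_condExp (hbd k A hA))
  have hdual : ∀ f : Ω → ℝ, Integrable f P → ∀ (k : ℕ) (A : Set Ω), MeasurableSet[𝓗] A →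
      ∫ ω, f ω * W k A ω ∂P = ∫ ω, (A ∩ B k).indicator (H f) ω ∂P := by
    intro f hf k A hA
    have hE := integral_mul_condExp h𝓖 hf (hbd k A hA)
    rw [hsplit, integral_add (integrable_mul_of_memLp_top integrable_condExp (hW1 k A hA))
      (integrable_mul_of_memLp_top integrable_condExp (hbd k A hA)), ← hE.2]
    simp only [W, mul_add]
    rw [integral_add (integrable_mul_of_memLp_top hf (hW1 k A hA))
      (integrable_mul_of_memLp_top hf hE.1)]
    congr 1
    have h1 : P[fun ω => f ω * (A ∩ B k).indicator (fun _ => c) ω | 𝓗] =ᵐ[P]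
        P[f | 𝓗] * (A ∩ B k).indicator (fun _ => c) :=
      condExp_mul_of_stronglyMeasurable_right
        (stronglyMeasurable_const.indicator (hA.inter (hB k)))
        (integrable_mul_of_memLp_top hf (hW1 k A hA)) hf
    rw [← integral_condExp h𝓗]
    exact integral_congr_ae h1
  have hpos : ∀ (k : ℕ) (A : Set Ω), MeasurableSet[𝓗] A →
      0 ≤ ∫ ω, (A ∩ B k).indicator (H g) ω ∂P := by
    intro k A hA
    rw [← hdual g hg k A hA]
    refine ge_of_tendsto (hlim _ (hW k A hA)) (h.mono fun i hi => ?_)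
    rw [hdual (f i) (hf i) k A hA]
    refine integral_nonneg_of_ae ?_
    filter_upwards [hi, hdd'] with ω h1 h2
    rw [h2] at h1
    exact Set.indicator_apply_nonneg fun _ => h1
  have hHm : StronglyMeasurable[𝓗] (H g) :=
    (stronglyMeasurable_const.mul stronglyMeasurable_condExp).add
      (hd'.mul (stronglyMeasurable_condExp.mono h𝓖𝓗))
  have hBk : ∀ k, 0 ≤ᵐ[P] (B k).indicator (H g) := by
    intro k
    refine ae_nonneg_of_forall_setIntegral_nonneg_of_stronglyMeasurable h𝓗
      (by simpa using hI g k Set.univ MeasurableSet.univ) (hHm.indicator (hB k)) fun A hA => ?_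
    rw [← integral_indicator (h𝓗 A hA), Set.indicator_indicator]
    exact hpos k A hA
  filter_upwards [ae_all_iff.2 hBk, hdd'] with ω h1 h2
  obtain ⟨k, hk⟩ := exists_nat_ge |d' ω|
  have := h1 k
  rw [Pi.zero_apply, Set.indicator_of_mem (show ω ∈ B k from hk)] at this
  rw [h2]
  exact this

end Limit

/-! ### A density for all times at once. -/

section Market

variable {Ω : Type*} {mΩ : MeasurableSpace Ω} {P : Measure Ω} [IsProbabilityMeasure P] {T : ℝ}
  {𝓕 : Filtration (Times T) mΩ} {m M : Times T → Times T → Ω → ℝ}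
  {L : Times T → Submodule ℝ (Lp ℝ ∞ P)} {x : ∀ s t : Times T, L t → L s}

/-- The densities on finite sets of times have a weak limit that is a density for all times. -/
theorem exists_isGridDensity_univ {z u : Times T} (hz : ∀ t, z ≤ t) (hu : ∀ t, t ≤ u)
    (hx : IsPriceFamily P 𝓕 L x) (hsand : Sandwich P 𝓕 m M L x)
    (hL : IsMarket P 𝓕 L) (hm : IsDensityFamily P 𝓕 m) (hM : IsDensityFamily P 𝓕 M)
    (hmM : ∀ s t, s ≤ t → ∀ᵐ ω ∂P, 0 < m s t ω ∧ m s t ω ≤ M s t ω) :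
    ∃ f, IsGridDensity P 𝓕 m M L x Set.univ z u f := by
  have hgrid : ∀ S : Finset (Times T), ∃ f, IsGridDensity P 𝓕 m M L x (insert u (insert z S)) z u f
      := by
    -- Inserting `z` forces the least grid time to be `z`, so all grid densities are normalized
    -- there and share one order interval.
    intro S
    obtain ⟨r, -, hr, f, hf⟩ := exists_isGridDensity hu hx hsand hL hm hM hmM (insert z S)
    obtain rfl := le_antisymm (hr z (by simp)) (hz r)
    exact ⟨f, by simpa using hf⟩
  choose f hf using hgrid
  let U : Ultrafilter (Finset (Times T)) := Ultrafilter.of atTop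
  have hU : (U : Filter (Finset (Times T))) ≤ atTop := Ultrafilter.of_le _
  have hmem : ∀ s, ∀ᶠ S : Finset (Times T) in U,
      s ∈ (insert u (insert z (S : Set (Times T))) : Set (Times T)) := fun s =>
    hU ((eventually_ge_atTop {s}).mono fun S hS => by
      have : s ∈ S := Finset.singleton_subset_iff.1 hS
      simp [this])
  obtain ⟨g, hg, hmg, hgM, hlim⟩ := exists_tendsto_integral_mul_of_ultrafilter
    (hm.integrable z u (hz u)) (hM.integrable z u (hz u)) ((hmM z u (hz u)).mono fun _ h => h.2) U f
    (fun S => (hf S).integrable) (fun S => (hf S).lower) (fun S => (hf S).upper)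
  have hset : ∀ (A : Set Ω) (f W : Ω → ℝ), MeasurableSet A →
      ∫ ω, f ω * A.indicator W ω ∂P = ∫ ω in A, f ω * W ω ∂P := by
    intro A f W hA
    rw [← integral_indicator hA]
    refine integral_congr_ae (.of_forall fun ω => ?_)
    by_cases hω : ω ∈ A <;> simp [hω]
  refine ⟨g, hg, hmg, hgM, ?_, ?_, ?_⟩
  · refine (ae_eq_condExp_of_forall_setIntegral_eq (𝓕.le z) hg
      (fun _ _ _ => (integrable_const 1).integrableOn) (fun A hA _ => ?_)
      aestronglyMeasurable_const).symm
    have hA' := 𝓕.le z A hA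
    have h := hlim _ ((memLp_const (1 : ℝ)).indicator hA')
    rw [hset A _ _ hA'] at h
    simp only [mul_one] at h
    refine tendsto_nhds_unique (tendsto_const_nhds.congr fun S => ?_) h
    rw [hset A _ _ hA']
    simp only [mul_one]
    rw [← setIntegral_condExp (𝓕.le z) (hf S).integrable hA]
    exact integral_congr_ae (ae_restrict_of_ae (hf S).normalized.symm)
  · intro s _ t _ hst X
    have hD : MemLp (fun ω => (X : Lp ℝ ∞ P) ω - (x s t X : Lp ℝ ∞ P) ω) ∞ P :=
      (Lp.memLp (X : Lp ℝ ∞ P)).sub (Lp.memLp (x s t X : Lp ℝ ∞ P))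
    refine condExp_eq_zero_of_forall_setIntegral_eq_zero (𝓕.le s)
      (integrable_mul_of_memLp_top hg hD) fun A hA => ?_
    have hA' := 𝓕.le s A hA
    have h := hlim _ (hD.indicator hA')
    rw [hset A _ _ hA'] at h
    refine tendsto_nhds_unique h (tendsto_const_nhds.congr' ?_)
    filter_upwards [hmem s, hmem t] with S hs ht
    rw [hset A _ _ hA', ← setIntegral_condExp (𝓕.le s)
      (integrable_mul_of_memLp_top (hf S).integrable hD) hA]
    rw [integral_congr_ae (ae_restrict_of_ae ((hf S).price s hs t ht hst X))]
    simp
  · intro s _ t _ hst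
    have h1 := add_condExp_nonneg_of_tendsto (𝓕.mono hst) (𝓕.le t) (fun S => (hf S).integrable) hg
      hlim 1 (hm.measurable s t hst).neg (by
        filter_upwards [hmem s, hmem t] with S hs ht
        filter_upwards [(hf S).bounds s hs t ht hst] with ω hω
        rw [Pi.neg_apply, neg_mul, one_mul]
        linarith [hω.1])
    have h2 := add_condExp_nonneg_of_tendsto (𝓕.mono hst) (𝓕.le t) (fun S => (hf S).integrable) hg
      hlim (-1) (hM.measurable s t hst) (by
        filter_upwards [hmem s, hmem t] with S hs ht
        filter_upwards [(hf S).bounds s hs t ht hst] with ω hω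
        linarith [hω.2])
    filter_upwards [h1, h2] with ω h1 h2
    rw [Pi.neg_apply, neg_mul, one_mul] at h1
    constructor <;> linarith

end Market

end PricingBounds

/-! ### Change of measure and the conditional pricing formulas. -/

theorem mainTheorem8 {Ω : Type*} {mΩ : MeasurableSpace Ω}
    (P : Measure Ω) [IsProbabilityMeasure P] [P.IsComplete]
    (T : ℝ) (hT : 0 < T)
    (𝓕 : Filtration (PricingBounds.Times T) mΩ) [𝓕.IsRightContinuous]
    (h𝓕T : 𝓕 ⟨T, hT.le, le_rfl⟩ = mΩ)
    (m M : PricingBounds.Times T → PricingBounds.Times T → Ω → ℝ)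
    (hm : PricingBounds.IsDensityFamily P 𝓕 m)
    (hM : PricingBounds.IsDensityFamily P 𝓕 M)
    (hmM : ∀ s t, s ≤ t → ∀ᵐ ω ∂P, 0 < m s t ω ∧ m s t ω ≤ M s t ω)
    (L : PricingBounds.Times T → Submodule ℝ (Lp ℝ ∞ P))
    (hL : PricingBounds.IsMarket P 𝓕 L)
    (x : ∀ s t : PricingBounds.Times T, L t → L s)
    (hx : PricingBounds.IsPriceFamily P 𝓕 L x)
    (hsand : PricingBounds.Sandwich P 𝓕 m M L x) :
    ∃ (f : Ω → ℝ) (P₀ : Measure Ω),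
      Integrable f P ∧ (∀ᵐ ω ∂P, 0 ≤ f ω) ∧
      P[f | 𝓕 ⟨0, le_rfl, hT.le⟩] =ᵐ[P] (fun _ => 1) ∧
      IsProbabilityMeasure P₀ ∧
      P₀ = P.withDensity (fun ω => ENNReal.ofReal (f ω)) ∧
      P₀ ≪ P ∧ P ≪ P₀ ∧
      (∀ s t, s ≤ t → ∀ X : L t,
        (((x s t X : Lp ℝ ∞ P) : Ω → ℝ) =ᵐ[P] P₀[((X : Lp ℝ ∞ P) : Ω → ℝ) | 𝓕 s]) ∧
        Integrable (fun ω => (X : Lp ℝ ∞ P) ω * (f ω / (P[f | 𝓕 s]) ω)) P ∧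
        (((x s t X : Lp ℝ ∞ P) : Ω → ℝ) =ᵐ[P]
          P[fun ω => (X : Lp ℝ ∞ P) ω * (f ω / (P[f | 𝓕 s]) ω) | 𝓕 s])) ∧
      (∀ s t, s ≤ t → ∀ᵐ ω ∂P,
        0 < (P[f | 𝓕 s]) ω ∧
        m s t ω ≤ (P[f | 𝓕 t]) ω / (P[f | 𝓕 s]) ω ∧
        (P[f | 𝓕 t]) ω / (P[f | 𝓕 s]) ω ≤ M s t ω) := by
  have hz : ∀ t : PricingBounds.Times T, ⟨0, le_rfl, hT.le⟩ ≤ t := fun t => t.2.1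
  have hu : ∀ t : PricingBounds.Times T, t ≤ ⟨T, hT.le, le_rfl⟩ := fun t => t.2.2
  obtain ⟨f, hf⟩ := PricingBounds.exists_isGridDensity_univ hz hu hx hsand hL hm hM hmM
  set z : PricingBounds.Times T := ⟨0, le_rfl, hT.le⟩
  set u : PricingBounds.Times T := ⟨T, hT.le, le_rfl⟩
  have hfI := hf.integrable
  have hf0 : ∀ᵐ ω ∂P, 0 < f ω := by
    filter_upwards [hmM z u (hz u), hf.lower] with ω h1 h2 using h1.1.trans_le h2
  have hfu : P[f | 𝓕 u] =ᵐ[P] f := by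
    rw [h𝓕T]
    exact condExp_of_aestronglyMeasurable' le_rfl hfI.1 hfI
  have hbounds : ∀ s t, s ≤ t → ∀ᵐ ω ∂P, 0 < (P[f | 𝓕 s]) ω ∧
      m s t ω ≤ (P[f | 𝓕 t]) ω / (P[f | 𝓕 s]) ω ∧
      (P[f | 𝓕 t]) ω / (P[f | 𝓕 s]) ω ≤ M s t ω := by
    intro s t hst
    -- Normalization at time `0` turns the bounds from `z` to `s` into `P[f | 𝓕 s] ≥ m z s > 0`.
    filter_upwards [hf.bounds z trivial s trivial (hz s), hf.normalized, hmM z s (hz s),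
      hf.bounds s trivial t trivial hst] with ω h1 h2 h3 h4
    rw [h2, mul_one] at h1
    have hpos : 0 < (P[f | 𝓕 s]) ω := h3.1.trans_le h1.1
    exact ⟨hpos, (le_div_iff₀ hpos).2 h4.1, (div_le_iff₀ hpos).2 h4.2⟩
  have hfm : AEMeasurable (fun ω => ENNReal.ofReal (f ω)) P := hfI.aemeasurable.ennreal_ofReal
  have hftop : ∀ᵐ ω ∂P, ENNReal.ofReal (f ω) < ∞ := .of_forall fun _ => ENNReal.ofReal_lt_top
  set P₀ : Measure Ω := P.withDensity fun ω => ENNReal.ofReal (f ω) with hP₀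
  have hprob : IsProbabilityMeasure P₀ := by
    refine ⟨?_⟩
    rw [hP₀, withDensity_apply _ MeasurableSet.univ, Measure.restrict_univ,
      ← ofReal_integral_eq_lintegral_ofReal hfI (hf0.mono fun _ h => h.le),
      ← integral_condExp (𝓕.le z), integral_congr_ae hf.normalized]
    simp
  have hPP₀ : P ≪ P₀ := withDensity_absolutelyContinuous' hfm
    (hf0.mono fun ω h => by simpa using h)
  have hP₀P : P₀ ≪ P := withDensity_absolutelyContinuous _ _
  have hP₀set : ∀ (A : Set Ω) (g : Ω → ℝ), MeasurableSet A →
      ∫ ω in A, g ω ∂P₀ = ∫ ω in A, f ω * g ω ∂P := by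
    intro A g hA
    rw [hP₀, restrict_withDensity hA, integral_withDensity_eq_integral_toReal_smul₀ hfm.restrict
      (ae_restrict_of_ae hftop)]
    refine integral_congr_ae (ae_restrict_of_ae ?_)
    filter_upwards [hf0] with ω hω
    rw [ENNReal.toReal_ofReal hω.le, smul_eq_mul]
  have hbdd : ∀ X : Lp ℝ ∞ P, Integrable X P₀ := by
    intro X
    rw [hP₀, integrable_withDensity_iff_integrable_smul₀' hfm hftop]
    refine (PricingBounds.integrable_mul_of_memLp_top hfI (Lp.memLp X)).congr ?_
    filter_upwards [hf0] with ω hω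
    rw [ENNReal.toReal_ofReal hω.le, smul_eq_mul]
  have hprice : ∀ s t, s ≤ t → ∀ X : L t, P[fun ω => f ω * (X : Lp ℝ ∞ P) ω | 𝓕 s] =ᵐ[P]
      fun ω => (P[f | 𝓕 s]) ω * (x s t X : Lp ℝ ∞ P) ω := by
    intro s t hst X
    filter_upwards [hf.price s trivial t trivial hst X, PricingBounds.condExp_mul_sub hfI
      (Lp.memLp (X : Lp ℝ ∞ P)) (Lp.memLp (x s t X : Lp ℝ ∞ P))
      (hL.aestronglyMeasurable (x s t X))] with ω h1 h2
    rw [h1, Pi.zero_apply] at h2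
    linarith
  refine ⟨f, P₀, hfI, hf0.mono fun _ h => h.le, hf.normalized, hprob, rfl, hP₀P, hPP₀,
    fun s t hst X => ⟨?_, ?_⟩, hbounds⟩
  -- Bayes' rule: over events of `𝓕 s`, the `P₀`-integrals of `X` and of its price both reduce to
  -- `P`-integrals of `P[f | 𝓕 s] * x s t X`.
  · refine hPP₀.ae_le (ae_eq_condExp_of_forall_setIntegral_eq (𝓕.le s) (hbdd X)
      (fun A _ _ => (hbdd _).integrableOn) (fun A hA _ => ?_)
      ((hL.aestronglyMeasurable (x s t X)).mono_ac hP₀P))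
    have hA' := 𝓕.le s A hA
    have hfx := PricingBounds.integrable_mul_of_memLp_top hfI (Lp.memLp (x s t X : Lp ℝ ∞ P))
    have hpull : P[fun ω => f ω * (x s t X : Lp ℝ ∞ P) ω | 𝓕 s] =ᵐ[P]
        P[f | 𝓕 s] * ((x s t X : Lp ℝ ∞ P) : Ω → ℝ) :=
      condExp_mul_of_aestronglyMeasurable_right (hL.aestronglyMeasurable (x s t X)) hfx hfI
    rw [hP₀set A _ hA', hP₀set A _ hA', ← setIntegral_condExp (𝓕.le s) hfx hA,
      ← setIntegral_condExp (𝓕.le s)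
        (PricingBounds.integrable_mul_of_memLp_top hfI (Lp.memLp (X : Lp ℝ ∞ P))) hA]
    exact integral_congr_ae (ae_restrict_of_ae (hpull.trans (hprice s t hst X).symm))
  -- The upper bound up to the terminal time, where `P[f | 𝓕 u] = f`, dominates this quotient by the
  -- integrable `M s u`.
  · have hfs : Integrable (fun ω => f ω / (P[f | 𝓕 s]) ω) P := by
      refine (hM.integrable s u (hu s)).mono
        (hfI.aemeasurable.div integrable_condExp.aemeasurable).aestronglyMeasurable ?_
      filter_upwards [hbounds s u (hu s), hfu, hf0] with ω h1 h2 h3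
      rw [h2] at h1
      rw [Real.norm_eq_abs, Real.norm_eq_abs, abs_of_pos (div_pos h3 h1.1)]
      exact h1.2.2.trans (le_abs_self _)
    have hI : Integrable (fun ω => (X : Lp ℝ ∞ P) ω * (f ω / (P[f | 𝓕 s]) ω)) P :=
      (PricingBounds.integrable_mul_of_memLp_top hfs (Lp.memLp (X : Lp ℝ ∞ P))).congr
        (.of_forall fun ω => mul_comm _ _)
    refine ⟨hI, ?_⟩
    have hfX := PricingBounds.integrable_mul_of_memLp_top hfI (Lp.memLp (X : Lp ℝ ∞ P))
    have heq : (fun ω => (X : Lp ℝ ∞ P) ω * (f ω / (P[f | 𝓕 s]) ω)) =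
        (fun ω => ((P[f | 𝓕 s]) ω)⁻¹) * fun ω => f ω * (X : Lp ℝ ∞ P) ω := by
      funext ω
      simp only [Pi.mul_apply, div_eq_mul_inv]
      ring
    have hpull := condExp_mul_of_aestronglyMeasurable_left (μ := P) (m := 𝓕 s)
      (f := fun ω => ((P[f | 𝓕 s]) ω)⁻¹) (g := fun ω => f ω * (X : Lp ℝ ∞ P) ω)
      (stronglyMeasurable_condExp.measurable.inv.stronglyMeasurable.aestronglyMeasurable)
      (heq ▸ hI) hfX
    rw [heq]
    filter_upwards [hpull, hprice s t hst X, hbounds s t hst] with ω h1 h2 h3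
    rw [h1, Pi.mul_apply, h2, inv_mul_cancel_left₀ h3.1.ne']
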